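/- Let $V$ be a finite set. All directed graphs $\mathcal G=(V,E)$ below contain every self-loop $i\to i$, $i\in V$; a *DAG* is such a graph with no directed cycle of length greater than one. Self-loops are ignored for the parents $\mathrm{pa}(i)$, the children $\mathrm{ch}(i)$, the neighbors $\mathrm{ne}(i)=\mathrm{pa}(i)\cup\mathrm{ch}(i)$ and the skeleton (the underlying undirected simple graph). The (Lyapunov) *model* of $\mathcal G$ is $$\mathcal M_{\mathcal G}=\{\Sigma\in\mathbb R^{V\times V}\ \text{symmetric positive definite}:\ M\Sigma+\Sigma M^T+2I=0\ \text{for some stable } M\in\mathbb R^{V\times V}\text{ with } m_{ji}=0 \text{ whenever } i\to j\notin E\},$$ where stable means that all eigenvalues have strictly negative real part. For $k,i,j\in V$ write $k\perp\!\!\!\perp\{i,j\}$ if $\sigma_{ki}=\sigma_{kj}=0$ for all $\Sigma\in\mathcal M_{\mathcal G}$ (marginal independence in the centered Gaussian distributions with covariance matrix in the model). An edge $i\to j$, $i\ne j$, of a DAG $\mathcal G$ is *super-covered* if * $\mathrm{ch}(i)=\mathrm{ch}(j)\cup\{j\}$ and $\mathrm{pa}(i)\cup\{i\}=\mathrm{pa}(j)$;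 * $k\to l\in E$ for all $k\in\mathrm{pa}(j)$ and $l\in\mathrm{ch}(i)$; * for every $k\in V\setminus\{i,j\}$, either $k\in\mathrm{ne}(i)\cap\mathrm{ne}(j)$ or $k\perp\!\!\!\perp\{i,j\}$. A *super-covered edge flip* replaces a super-covered edge $i\to j$ of a DAG by $j\to i$. **Theorem.** Let $\mathcal G_1$ and $\mathcal G_2$ be two DAGs on the vertex set $V$, with $|V|\ge 4$, such that the induced subgraphs satisfy $\mathcal M_{\mathcal G_1[K]}=\mathcal M_{\mathcal G_2[K]}$ for every subset $K\subseteq V$ of size four. Then $\mathcal G_1$ and $\mathcal G_2$ have the same skeleton, and there exists a sequence of exactly $\delta=|E(\mathcal G_1)\setminus E(\mathcal G_2)|$ super-covered edge flips, passing only through DAGs, which transforms $\mathcal G_1$ into $\mathcal G_2$. In particular, $\mathcal M_{\mathcal G_1}=\mathcal M_{\mathcal G_2}$. -/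

import Mathlib

/-!
A directed graph on `V` is a `Digraph V`, and `G.Adj i j` means that `i → j` is an edge of `G`.
The self-loops `i → i` are genuine edges (they allow the diagonal of the drift matrix to be
nonzero); they are ignored by parents, children, neighbours, skeletons and acyclicity.
-/

namespace Lyapunov

section Graphs

variable {V : Type*}

/-- The edge set of `G`, self-loops included. -/
def edges (G : Digraph V) : Set (V × V) := {e | G.Adj e.1 e.2}

/-- A DAG: every self-loop is present and there is no directed cycle of length greater than one,
that is, no nonempty closed walk along non-loop edges. -/
def IsDAG (G : Digraph V) : Prop :=
  (∀ i, G.Adj i i) ∧ ∀ i, ¬ Relation.TransGen (fun a b => a ≠ b ∧ G.Adj a b) i i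

/-- The parents of `i`. -/
def pa (G : Digraph V) (i : V) : Set V := {k | k ≠ i ∧ G.Adj k i}

/-- The children of `i`. -/
def ch (G : Digraph V) (i : V) : Set V := {k | k ≠ i ∧ G.Adj i k}

/-- The neighbours of `i`. -/
def nbr (G : Digraph V) (i : V) : Set V := pa G i ∪ ch G i

/-- The skeleton of `G`: distinct `i`, `j` are joined iff `i → j` or `j → i` is an edge. -/
def skeleton (G : Digraph V) : SimpleGraph V := G.toSimpleGraphInclusive

/-- The induced subgraph `G[K]`, a directed graph with vertex set `K`. -/
def induce (G : Digraph V) (K : Finset V) : Digraph K where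
  Adj a b := G.Adj a b

/-- The graph obtained from `G` by replacing the edge `i → j` by `j → i`. -/
def flip (G : Digraph V) (i j : V) : Digraph V where
  Adj a b := (G.Adj a b ∧ ¬ (a = i ∧ b = j)) ∨ (a = j ∧ b = i)

end Graphs

section Models

variable {V : Type*} [Fintype V] [DecidableEq V]

/-- A real square matrix is stable if all its complex eigenvalues have negative real part. -/
def IsStable (M : Matrix V V ℝ) : Prop :=
  ∀ z ∈ spectrum ℂ (M.map (algebraMap ℝ ℂ)), z.re < 0

/-- The space `ℝ^E` of `G`-sparse matrices: `M j i = 0` whenever `i → j` is not an edge. -/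
def sparse (G : Digraph V) : Set (Matrix V V ℝ) := {M | ∀ i j, ¬ G.Adj i j → M j i = 0}

/-- The graphical continuous Lyapunov model of `G` with volatility matrix `C`, as a set of
covariance matrices. -/
def gclm (G : Digraph V) (C : Matrix V V ℝ) : Set (Matrix V V ℝ) :=
  {S | S.PosDef ∧ ∃ M ∈ sparse G, IsStable M ∧ M * S + S * M.transpose + C = 0}

/-- The model of `G`, with volatility matrix `2 I`. -/
def model (G : Digraph V) : Set (Matrix V V ℝ) := gclm G ((2 : ℝ) • (1 : Matrix V V ℝ))

/-- Marginal independence of `X k` and `(X i, X j)` in the model of `G`: for every centered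
Gaussian vector `X` with covariance matrix in the model, the covariances of `X k` with `X i`
and with `X j` vanish. -/
def MargIndep (G : Digraph V) (k i j : V) : Prop :=
  ∀ S ∈ model G, S k i = 0 ∧ S k j = 0

/-- `i → j` is a super-covered (non-loop) edge of `G`. -/
structure IsSuperCovered (G : Digraph V) (i j : V) : Prop where
  ne : i ≠ j
  adj : G.Adj i j
  ch_eq : ch G i = ch G j ∪ {j}
  pa_eq : pa G i ∪ {i} = pa G j
  pa_ch : ∀ k ∈ pa G j, ∀ l ∈ ch G i, G.Adj k l
  rest : ∀ k, k ≠ i → k ≠ j → k ∈ nbr G i ∩ nbr G j ∨ MargIndep G k i j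

/-- `G'` arises from the DAG `G` by flipping one super-covered edge. -/
def IsSuperCoveredFlip (G G' : Digraph V) : Prop :=
  IsDAG G ∧ ∃ i j, IsSuperCovered G i j ∧ G' = flip G i j

/-- A sequence of exactly `n` super-covered edge flips transforms `G₁` into `G₂`, all graphs in
the sequence being DAGs. -/
def TransformsInFlips (n : ℕ) (G₁ G₂ : Digraph V) : Prop :=
  ∃ H : Fin (n + 1) → Digraph V, H 0 = G₁ ∧ H (Fin.last n) = G₂ ∧
    (∀ t, IsDAG (H t)) ∧ ∀ t : Fin n, IsSuperCoveredFlip (H t.castSucc) (H t.succ)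

end Models

end Lyapunov

/-!
Let `S` be in the model of `G`, so that `M * S + S * Mᵀ + 2 • 1 = 0` with `M ∈ sparse G`. The other
solutions of this equation are `M + K * S⁻¹` with `K` skew-symmetric. When `i → j` satisfies the
graphical conditions below, a skew-symmetric `K` can be found for which the new drift matrix is
sparse for the graph with `i → j` flipped, so the flip does not change the model.

Dually, let `Q` be symmetric with `(S * Q) a b = 0` for every edge `a → b` of `H`. Pairing the
Lyapunov equation of `H` with `Q` gives `Q.trace = 0`, so `Q.trace ≠ 0` certifies `S ∉ model H`.
Explicit certificates on at most four vertices show that graphs with the same models on four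
vertices have the same skeleton, and that a reversed edge which is not bridged by a directed path
of length two satisfies the graphical conditions. A reversed edge whose endpoints are closest in a
topological numbering is not bridged; flipping it lowers `|E(G₁) \ E(G₂)|` by one and keeps the
four-vertex models.
-/

namespace Lyapunov

section LyapunovEquation

open Matrix

variable {V : Type*}

lemma isSymm_of_posDef {S : Matrix V V ℝ} (hS : S.PosDef) : S.IsSymm :=
  isHermitian_iff_isSymm.mp hS.isHermitian

variable [Fintype V] [DecidableEq V] {G H : Digraph V} {M S Q : Matrix V V ℝ}

lemma dotProduct_mulVec_transpose_mulVec_self (hS : S.IsSymm)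
    (hL : M * S + S * Mᵀ + (2 : ℝ) • (1 : Matrix V V ℝ) = 0) (x : V → ℝ) :
    x ⬝ᵥ S *ᵥ Mᵀ *ᵥ x = -(x ⬝ᵥ x) := by
  have hx : x ⬝ᵥ (M * S + S * Mᵀ + (2 : ℝ) • (1 : Matrix V V ℝ)) *ᵥ x = 0 := by
    rw [hL, zero_mulVec, dotProduct_zero]
  have hMS : x ⬝ᵥ (M * S) *ᵥ x = x ⬝ᵥ S *ᵥ Mᵀ *ᵥ x := by
    rw [mulVec_mulVec, ← dotProduct_transpose_mulVec, transpose_mul, hS.eq]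
  rw [add_mulVec, add_mulVec, dotProduct_add, dotProduct_add, hMS, ← mulVec_mulVec, smul_mulVec,
    one_mulVec, dotProduct_smul, smul_eq_mul] at hx
  linarith

lemma exists_real_mulVec_eq_of_mem_spectrum {z : ℂ}
    (hz : z ∈ spectrum ℂ (M.map (algebraMap ℝ ℂ))) :
    ∃ x y : V → ℝ, ¬ (x = 0 ∧ y = 0) ∧ M *ᵥ x = z.re • x - z.im • y ∧
      M *ᵥ y = z.re • y + z.im • x := by
  rw [← spectrum_toLin', ← Module.End.hasEigenvalue_iff_mem_spectrum] at hz
  obtain ⟨w, hw⟩ := hz.exists_hasEigenvector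
  have hMw := hw.apply_eq_smul
  rw [toLin'_apply] at hMw
  refine ⟨fun i => (w i).re, fun i => (w i).im, fun ⟨hre, him⟩ => hw.2 ?_, ?_, ?_⟩
  · ext i
    exact Complex.ext (congrFun hre i) (congrFun him i)
  · ext i
    simpa [mulVec, dotProduct] using congrArg Complex.re (congrFun hMw i)
  · ext i
    simpa [mulVec, dotProduct] using congrArg Complex.im (congrFun hMw i)

lemma isStable_of_lyapunov (hS : S.PosDef)
    (hL : M * S + S * Mᵀ + (2 : ℝ) • (1 : Matrix V V ℝ) = 0) : IsStable M := by
  intro z hz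
  replace hz : z ∈ spectrum ℂ (Mᵀ.map (algebraMap ℝ ℂ)) := by
    rw [transpose_map, mem_spectrum_iff_isRoot_charpoly, charpoly_transpose,
      ← mem_spectrum_iff_isRoot_charpoly]
    exact hz
  obtain ⟨x, y, hxy, hx, hy⟩ := exists_real_mulVec_eq_of_mem_spectrum hz
  have hSymm := isSymm_of_posDef hS
  have ex := dotProduct_mulVec_transpose_mulVec_self hSymm hL x
  have ey := dotProduct_mulVec_transpose_mulVec_self hSymm hL y
  have hcomm : y ⬝ᵥ S *ᵥ x = x ⬝ᵥ S *ᵥ y := by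
    rw [← dotProduct_transpose_mulVec, hSymm.eq]
  simp only [hx, hy, mulVec_sub, mulVec_add, mulVec_smul, dotProduct_sub, dotProduct_add,
    dotProduct_smul, smul_eq_mul, hcomm] at ex ey
  have hre : z.re * (x ⬝ᵥ S *ᵥ x + y ⬝ᵥ S *ᵥ y) = -(x ⬝ᵥ x + y ⬝ᵥ y) := by linarith
  have hSx : 0 ≤ x ⬝ᵥ S *ᵥ x := by simpa using hS.posSemidef.dotProduct_mulVec_nonneg x
  have hSy : 0 ≤ y ⬝ᵥ S *ᵥ y := by simpa using hS.posSemidef.dotProduct_mulVec_nonneg y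
  have hxx : 0 ≤ x ⬝ᵥ x := by simpa using dotProduct_star_self_nonneg x
  have hyy : 0 ≤ y ⬝ᵥ y := by simpa using dotProduct_star_self_nonneg y
  have hpos : 0 < x ⬝ᵥ x + y ⬝ᵥ y := by
    refine lt_of_le_of_ne (by positivity) fun h0 => hxy ⟨?_, ?_⟩
    · exact dotProduct_self_eq_zero.mp (by linarith)
    · exact dotProduct_self_eq_zero.mp (by linarith)
  by_contra hneg
  linarith only [hre, hpos, mul_nonneg (not_lt.mp hneg) (add_nonneg hSx hSy)]

lemma mem_model_iff :
    S ∈ model G ↔ S.PosDef ∧ ∃ M ∈ sparse G,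
      M * S + S * Mᵀ + (2 : ℝ) • (1 : Matrix V V ℝ) = 0 :=
  ⟨fun ⟨hS, M, hM, _, hL⟩ => ⟨hS, M, hM, hL⟩,
    fun ⟨hS, M, hM, hL⟩ => ⟨hS, M, hM, isStable_of_lyapunov hS hL, hL⟩⟩

lemma trace_eq_zero_of_mem_model (hS : S ∈ model H) (hQ : Q.IsSymm)
    (hSQ : ∀ a b, H.Adj a b → (S * Q) a b = 0) : Q.trace = 0 := by
  obtain ⟨hpd, M, hM, hL⟩ := mem_model_iff.mp hS
  have hMSQ : (M * (S * Q)).trace = 0 := by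
    refine Finset.sum_eq_zero fun b _ => ?_
    rw [diag_apply, mul_apply]
    refine Finset.sum_eq_zero fun a _ => ?_
    by_cases hab : H.Adj a b
    · rw [hSQ a b hab, mul_zero]
    · rw [hM a b hab, zero_mul]
  have hSMQ : (S * Mᵀ * Q).trace = (M * (S * Q)).trace := by
    rw [← trace_transpose, transpose_mul, transpose_mul, transpose_transpose, hQ.eq,
      (isSymm_of_posDef hpd).eq, trace_mul_comm, Matrix.mul_assoc]
  have htr := congrArg (fun X => (X * Q).trace) hL
  simp only [Matrix.add_mul, trace_add, hSMQ, Matrix.mul_assoc M, hMSQ, smul_mul, Matrix.one_mul,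
    trace_smul, smul_eq_mul, Matrix.zero_mul, trace_zero] at htr
  linarith

lemma not_model_subset_model_of_trace_ne_zero (hS : S ∈ model G) (hQ : Q.IsSymm)
    (hSQ : ∀ a b, H.Adj a b → (S * Q) a b = 0) (htr : Q.trace ≠ 0) : ¬ model G ⊆ model H :=
  fun hsub => htr (trace_eq_zero_of_mem_model (hsub hS) hQ hSQ)

end LyapunovEquation

section MarginalPrecision

open Matrix

variable {V : Type*} [Fintype V] [DecidableEq V]

/-- `P` is the precision matrix of the marginal distribution on `A` of the centered Gaussian
distribution with covariance matrix `S`, padded with zeros: the inverse of the principal submatrix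
of `S` on `A`, with the rows and columns outside `A` set to zero. -/
structure IsMarginalPrecision (S : Matrix V V ℝ) (A : Set V) (P : Matrix V V ℝ) : Prop where
  posSemidef : P.PosSemidef
  apply_eq_zero : ∀ a ∉ A, ∀ b, P a b = 0
  mul_apply_eq_one : ∀ a ∈ A, ∀ b, (S * P) a b = (1 : Matrix V V ℝ) a b

variable {S P : Matrix V V ℝ} {A : Set V}

lemma exists_isMarginalPrecision (hS : S.PosDef) (A : Set V) :
    ∃ P, IsMarginalPrecision S A P := by
  classical
  let J : Matrix V A ℝ := (1 : Matrix V V ℝ).submatrix id Subtype.val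
  have hSA : (Jᵀ * S * J).PosDef := by
    have h : Jᵀ * S * J = S.submatrix Subtype.val Subtype.val := by
      ext a b
      simp [J, mul_apply, one_apply]
    exact h ▸ hS.submatrix Subtype.val_injective
  have hrow : ∀ (X : Matrix V V ℝ) (a : A) (b : V), (Jᵀ * X) a b = X a b := fun X a b => by
    simp [J, mul_apply, one_apply]
  refine ⟨J * (Jᵀ * S * J)⁻¹ * Jᵀ, ?_, fun a ha b => ?_, fun a ha b => ?_⟩
  · exact hSA.inv.posSemidef.mul_mul_conjTranspose_same J
  · have hJ : ∀ c, J a c = 0 := fun c => one_apply_ne fun h : a = c => ha (h ▸ c.2)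
    simp [Matrix.mul_assoc, mul_apply (M := J), hJ]
  · rw [← hrow (S * _) ⟨a, ha⟩, ← hrow 1 ⟨a, ha⟩, Matrix.mul_one]
    have hcancel : Jᵀ * (S * (J * (Jᵀ * S * J)⁻¹ * Jᵀ))
        = Jᵀ * S * J * (Jᵀ * S * J)⁻¹ * Jᵀ := by simp only [Matrix.mul_assoc]
    rw [hcancel, mul_nonsing_inv _ ((isUnit_iff_isUnit_det _).mp hSA.isUnit), Matrix.one_mul]

namespace IsMarginalPrecision

lemma isSymm (hP : IsMarginalPrecision S A P) : P.IsSymm :=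
  isHermitian_iff_isSymm.mp hP.posSemidef.isHermitian

lemma mul_mul_apply (hP : IsMarginalPrecision S A P) {a : V} (ha : a ∈ A) (X : Matrix V V ℝ)
    (b : V) : (S * P * X) a b = X a b := by
  rw [mul_apply]
  simp only [hP.mul_apply_eq_one a ha, one_apply, ite_mul, one_mul, zero_mul, Finset.sum_ite_eq,
    Finset.mem_univ, if_true]

lemma mul_apply_eq_zero (hP : IsMarginalPrecision S A P) {b : V} (hb : b ∉ A)
    (X : Matrix V V ℝ) (a : V) : (X * P) a b = 0 := by
  rw [mul_apply]
  refine Finset.sum_eq_zero fun c _ => ?_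
  rw [← hP.isSymm.apply c b, hP.apply_eq_zero b hb, mul_zero]

lemma apply_self_pos (hP : IsMarginalPrecision S A P) {a : V} (ha : a ∈ A) : 0 < P a a := by
  refine hP.posSemidef.diag_nonneg.lt_of_ne' fun h0 => ?_
  have hcol : P.col a = 0 := by
    simpa using (hP.posSemidef.dotProduct_mulVec_zero_iff (Pi.single a 1)).mp (by simpa using h0)
  have hmul : (S * P) a a = (S *ᵥ P.col a) a := rfl
  rw [hP.mul_apply_eq_one a ha, one_apply_eq, hcol, mulVec_zero] at hmul
  exact one_ne_zero hmul

end IsMarginalPrecision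

end MarginalPrecision

section Ancestral

open Matrix

variable {V : Type*} {G : Digraph V} {A R : Set V}

/-- `A` contains the parents of its members. -/
def IsAncestral (G : Digraph V) (A : Set V) : Prop := ∀ a b, G.Adj a b → b ∈ A → a ∈ A

variable [Fintype V] [DecidableEq V] {S P P' : Matrix V V ℝ}

lemma mul_cross_precision_apply_eq_zero (hA : IsAncestral G A) (hR : IsAncestral G R)
    (hdisj : Disjoint A R) (hP : IsMarginalPrecision S A P) (hP' : IsMarginalPrecision S R P')
    {a b : V} (hab : G.Adj a b) :
    (S * (P * S * P' * S * P + P' * S * P * S * P' - P * S * P' - P' * S * P)) a b = 0 := by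
  have hexpand : S * (P * S * P' * S * P + P' * S * P * S * P' - P * S * P' - P' * S * P)
      = S * P * (S * P' * S * P) + S * P' * (S * P * S * P') - S * P * (S * P')
        - S * P' * (S * P) := by
    simp only [Matrix.mul_add, Matrix.mul_sub, Matrix.mul_assoc]
  rw [hexpand, Matrix.sub_apply, Matrix.sub_apply, Matrix.add_apply]
  by_cases hbA : b ∈ A
  · have haA := hA a b hab hbA
    have hbR : b ∉ R := hdisj.notMem_of_mem_left hbA
    rw [hP.mul_mul_apply haA, hP.mul_mul_apply haA, ← Matrix.mul_assoc (S * P') (S * P * S) P',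
      hP'.mul_apply_eq_zero hbR, hP'.mul_apply_eq_zero hbR, ← Matrix.mul_assoc (S * P') S P]
    ring
  by_cases hbR : b ∈ R
  · have haR := hR a b hab hbR
    rw [hP'.mul_mul_apply haR, hP'.mul_mul_apply haR, ← Matrix.mul_assoc (S * P) (S * P' * S) P,
      hP.mul_apply_eq_zero hbA, hP.mul_apply_eq_zero hbA, ← Matrix.mul_assoc (S * P) S P']
    ring
  · simp only [← Matrix.mul_assoc, hP.mul_apply_eq_zero hbA, hP'.mul_apply_eq_zero hbR]
    ring

lemma trace_mul_mul_eq_zero_of_disjoint (hdisj : Disjoint A R) (hP : IsMarginalPrecision S A P)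
    (hP' : IsMarginalPrecision S R P') (X : Matrix V V ℝ) : (P * X * P').trace = 0 := by
  refine Finset.sum_eq_zero fun a _ => ?_
  by_cases ha : a ∈ R
  · have haA : a ∉ A := hdisj.notMem_of_mem_right ha
    simp [Matrix.mul_assoc, mul_apply (M := P), hP.apply_eq_zero a haA]
  · rw [diag_apply, hP'.mul_apply_eq_zero ha]

-- The trace of the symmetric matrix of `hQ` vanishes. It is the sum of two positive semidefinite
-- matrices and two matrices of trace zero, so both positive semidefinite matrices vanish.
lemma cross_precision_eq_zero (hS : S ∈ model G) (hA : IsAncestral G A)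
    (hR : IsAncestral G R) (hdisj : Disjoint A R) (hP : IsMarginalPrecision S A P)
    (hP' : IsMarginalPrecision S R P') : P * S * P' * S * P = 0 := by
  have hSymm := isSymm_of_posDef hS.1
  have hpsd : (P * S * P' * S * P).PosSemidef := by
    simpa [hP.isSymm.eq, hSymm.eq, Matrix.mul_assoc] using
      hP'.posSemidef.mul_mul_conjTranspose_same (P * S)
  have hpsd' : (P' * S * P * S * P').PosSemidef := by
    simpa [hP'.isSymm.eq, hSymm.eq, Matrix.mul_assoc] using
      hP.posSemidef.mul_mul_conjTranspose_same (P' * S)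
  have hQ : (P * S * P' * S * P + P' * S * P * S * P' - P * S * P' - P' * S * P).IsSymm := by
    simp only [IsSymm, transpose_sub, transpose_add, transpose_mul, hP.isSymm.eq, hP'.isSymm.eq,
      hSymm.eq, Matrix.mul_assoc]
    abel
  have htrace := trace_eq_zero_of_mem_model hS hQ fun a b hab =>
    mul_cross_precision_apply_eq_zero hA hR hdisj hP hP' hab
  rw [trace_sub, trace_sub, trace_add, trace_mul_mul_eq_zero_of_disjoint hdisj hP hP',
    trace_mul_mul_eq_zero_of_disjoint hdisj.symm hP' hP] at htrace
  exact hpsd.trace_eq_zero_iff.mp (by linarith [hpsd.trace_nonneg, hpsd'.trace_nonneg])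

theorem apply_eq_zero_of_disjoint_ancestral (hS : S ∈ model G) (hA : IsAncestral G A)
    (hR : IsAncestral G R) (hdisj : Disjoint A R) {a r : V} (ha : a ∈ A) (hr : r ∈ R) :
    S r a = 0 := by
  have hSymm := isSymm_of_posDef hS.1
  obtain ⟨P, hP⟩ := exists_isMarginalPrecision hS.1 A
  obtain ⟨P', hP'⟩ := exists_isMarginalPrecision hS.1 R
  have hquad : (S * P' * S) a a = 0 := by
    have hzero : S * P * (S * P' * (S * P * S)ᵀ) = S * (P * S * P' * S * P) * S := by
      simp only [transpose_mul, hSymm.eq, hP.isSymm.eq, Matrix.mul_assoc]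
    rw [cross_precision_eq_zero hS hA hR hdisj hP hP', Matrix.mul_zero,
      Matrix.zero_mul] at hzero
    have haa := congrFun (congrFun hzero a) a
    rw [hP.mul_mul_apply ha, mul_apply] at haa
    rw [mul_apply]
    simpa only [transpose_apply, hP.mul_mul_apply ha, hSymm.apply a, Matrix.zero_apply] using haa
  have hcol : P' *ᵥ S.col a = 0 := by
    refine (hP'.posSemidef.dotProduct_mulVec_zero_iff _).mp ?_
    rw [← hquad, Matrix.mul_assoc, mul_apply, dotProduct]
    simp [mulVec, dotProduct, mul_apply, hSymm.apply]
  have hSPS : (S * P' * S) r a = (S *ᵥ P' *ᵥ S.col a) r := by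
    rw [Matrix.mul_assoc]; rfl
  rw [hcol, mulVec_zero, hP'.mul_mul_apply hr] at hSPS
  exact hSPS

end Ancestral

section Comap

variable {V W : Type*} {G : Digraph V} {f : W → V} {a b : W}

/-- The pullback of a directed graph along a map of vertices. Along the inclusion of a set of
vertices this is the induced subgraph. -/
def comap (f : W → V) (G : Digraph V) : Digraph W where
  Adj a b := G.Adj (f a) (f b)

lemma mem_pa_comap (hf : f.Injective) : b ∈ pa (comap f G) a ↔ f b ∈ pa G (f a) :=
  and_congr hf.ne_iff.symm Iff.rfl

lemma mem_ch_comap (hf : f.Injective) : b ∈ ch (comap f G) a ↔ f b ∈ ch G (f a) :=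
  and_congr hf.ne_iff.symm Iff.rfl

lemma mem_nbr_comap (hf : f.Injective) : b ∈ nbr (comap f G) a ↔ f b ∈ nbr G (f a) :=
  or_congr (mem_pa_comap hf) (mem_ch_comap hf)

lemma comap_flip (hf : f.Injective) (G : Digraph V) (a b : W) :
    comap f (flip G (f a) (f b)) = flip (comap f G) a b := by
  ext x y
  simp [comap, flip, hf.eq_iff]

lemma comap_flip_of_notMem_range {i j : V} (h : ¬ (i ∈ Set.range f ∧ j ∈ Set.range f))
    (G : Digraph V) : comap f (flip G i j) = comap f G := by
  ext x y
  simp only [comap, flip]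
  grind

lemma IsDAG.comap (hG : IsDAG G) (hf : f.Injective) : IsDAG (comap f G) :=
  ⟨fun _ => hG.1 _, fun i hi => hG.2 (f i) (hi.lift f fun _ _ h => ⟨hf.ne h.1, h.2⟩)⟩

lemma IsDAG.not_adj_symm {i j : V} (hG : IsDAG G) (hne : i ≠ j) (hij : G.Adj i j) :
    ¬ G.Adj j i :=
  fun hji => hG.2 i ((Relation.TransGen.single ⟨hne, hij⟩).tail ⟨hne.symm, hji⟩)

lemma IsDAG.not_adj_of_path {i j k : V} (hG : IsDAG G) (hij : i ≠ j) (hjk : j ≠ k)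
    (h : G.Adj i j) (h' : G.Adj j k) : ¬ G.Adj k i := fun hki => by
  by_cases hik : k = i
  · exact hG.not_adj_symm hij h (hik ▸ h')
  · exact hG.2 i (((Relation.TransGen.single ⟨hij, h⟩).tail ⟨hjk, h'⟩).tail ⟨hik, hki⟩)

end Comap

section SuperCovered

open Matrix

variable {V : Type*} {G : Digraph V} {i j : V}

/-- The purely graphical form of a super-covered edge of a DAG: marginal independence is replaced
by the absence of edges between non-neighbours of `i` and the neighbours of `i`, except that a
non-neighbour may point to a child of `i`. -/
structure IsGraphSuperCovered (G : Digraph V) (i j : V) : Prop where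
  ne : i ≠ j
  adj : G.Adj i j
  mem_pa_iff : ∀ k, k ≠ i → (k ∈ pa G i ↔ k ∈ pa G j)
  mem_ch_iff : ∀ k, k ≠ j → (k ∈ ch G i ↔ k ∈ ch G j)
  adj_of_mem_pa_of_mem_ch : ∀ p ∈ pa G i, ∀ c ∈ ch G j, G.Adj p c
  notMem_nbr_pa : ∀ r ∉ nbr G i, r ≠ i → ∀ p ∈ pa G i, r ∉ nbr G p
  not_adj_of_mem_ch : ∀ r ∉ nbr G i, r ≠ i → ∀ c ∈ ch G j, ¬ G.Adj c r

namespace IsGraphSuperCovered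

lemma comap {W : Type*} {f : W → V} (hf : f.Injective) {a b : W}
    (h : IsGraphSuperCovered G (f a) (f b)) : IsGraphSuperCovered (comap f G) a b where
  ne := ne_of_apply_ne f h.ne
  adj := h.adj
  mem_pa_iff k hk := by
    simpa only [mem_pa_comap hf] using h.mem_pa_iff (f k) (hf.ne hk)
  mem_ch_iff k hk := by
    simpa only [mem_ch_comap hf] using h.mem_ch_iff (f k) (hf.ne hk)
  adj_of_mem_pa_of_mem_ch p hp c hc :=
    h.adj_of_mem_pa_of_mem_ch (f p) ((mem_pa_comap hf).mp hp) (f c) ((mem_ch_comap hf).mp hc)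
  notMem_nbr_pa r hr hri p hp := (mem_nbr_comap hf).not.mpr <|
    h.notMem_nbr_pa (f r) ((mem_nbr_comap hf).not.mp hr) (hf.ne hri) (f p)
      ((mem_pa_comap hf).mp hp)
  not_adj_of_mem_ch r hr hri c hc :=
    h.not_adj_of_mem_ch (f r) ((mem_nbr_comap hf).not.mp hr) (hf.ne hri) (f c)
      ((mem_ch_comap hf).mp hc)

lemma flip_eq_comap_swap [DecidableEq V] (hG : IsDAG G) (h : IsGraphSuperCovered G i j) :
    flip G i j = Lyapunov.comap (Equiv.swap i j) G := by
  have hji : ¬ G.Adj j i := hG.not_adj_symm h.ne h.adj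
  have hpa : ∀ k, k ≠ i → k ≠ j → (G.Adj k i ↔ G.Adj k j) := fun k hki hkj => by
    simpa [pa, hki, hkj] using h.mem_pa_iff k hki
  have hch : ∀ k, k ≠ i → k ≠ j → (G.Adj i k ↔ G.Adj j k) := fun k hki hkj => by
    simpa [ch, hki, hkj] using h.mem_ch_iff k hkj
  ext a b
  simp only [flip, Lyapunov.comap, Equiv.swap_apply_def]
  grind [h.ne, h.adj, hG.1 i, hG.1 j]

lemma isDAG_flip (hG : IsDAG G) (h : IsGraphSuperCovered G i j) : IsDAG (flip G i j) := by
  classical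
  rw [h.flip_eq_comap_swap hG]
  exact hG.comap (Equiv.swap i j).injective

lemma flip (hG : IsDAG G) (h : IsGraphSuperCovered G i j) :
    IsGraphSuperCovered (flip G i j) j i := by
  classical
  rw [h.flip_eq_comap_swap hG]
  refine .comap (Equiv.swap i j).injective ?_
  rwa [Equiv.swap_apply_right, Equiv.swap_apply_left]

lemma flip_flip (hG : IsDAG G) (h : IsGraphSuperCovered G i j) :
    Lyapunov.flip (Lyapunov.flip G i j) j i = G := by
  have := h.ne
  have := h.adj
  have := hG.not_adj_symm h.ne h.adj
  ext a b
  simp only [Lyapunov.flip]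
  grind

lemma isAncestral_setOf_adj (hG : IsDAG G) (h : IsGraphSuperCovered G i j) :
    IsAncestral G {a | G.Adj a j} := by
  intro k a hka haj
  by_cases hki : k = i
  · exact hki ▸ h.adj
  by_cases haj' : a = j
  · exact haj' ▸ hka
  by_cases hai : a = i
  · exact ((h.mem_pa_iff k hki).mp ⟨hki, hai ▸ hka⟩).2
  by_cases hka' : k = a
  · exact hka' ▸ haj
  have hap : a ∈ pa G i := (h.mem_pa_iff a hai).mpr ⟨haj', haj⟩
  by_contra hkj
  refine h.notMem_nbr_pa k (fun hk => ?_) hki a hap (Or.inl ⟨hka', hka⟩)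
  rcases hk with hk | hk
  · exact hkj ((h.mem_pa_iff k hki).mp hk).2
  · exact hG.not_adj_of_path hka' hai hka hap.2 hk.2

lemma isAncestral_nonneighbours (h : IsGraphSuperCovered G i j) :
    IsAncestral G {r | r ≠ i ∧ r ∉ nbr G i} := by
  rintro k r hkr ⟨hri, hr⟩
  refine ⟨fun hki => hr (Or.inr ⟨hri, hki ▸ hkr⟩), fun hk => ?_⟩
  have hrk : r ≠ k := fun hrk => hr (hrk ▸ hk)
  rcases hk with hk | hk
  · exact h.notMem_nbr_pa r hr hri k hk (Or.inr ⟨hrk, hkr⟩)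
  by_cases hkj : k = j
  · subst hkj
    exact hr (Or.inr ((h.mem_ch_iff r hrk).mpr ⟨hrk, hkr⟩))
  · exact h.not_adj_of_mem_ch r hr hri k ((h.mem_ch_iff k hkj).mp hk) hkr

lemma disjoint_setOf_adj_nonneighbours (h : IsGraphSuperCovered G i j) :
    Disjoint {a | G.Adj a j} {r | r ≠ i ∧ r ∉ nbr G i} := by
  refine Set.disjoint_left.mpr fun a haj ⟨hai, ha⟩ => ha ?_
  by_cases haj' : a = j
  · exact haj' ▸ Or.inr ⟨h.ne.symm, h.adj⟩
  · exact Or.inl ((h.mem_pa_iff a hai).mpr ⟨haj', haj⟩)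

lemma mem_ch_or_nonneighbour (h : IsGraphSuperCovered G i j) {b : V} (hb : ¬ G.Adj b j) :
    b ∈ ch G i ∨ b ∈ {r | r ≠ i ∧ r ∉ nbr G i} := by
  have hbi : b ≠ i := fun hbi => hb (hbi ▸ h.adj)
  have hpa : b ∉ pa G i := fun hbpa => hb ((h.mem_pa_iff b hbi).mp hbpa).2
  by_cases hch : b ∈ ch G i
  · exact Or.inl hch
  · exact Or.inr ⟨hbi, fun hnbr => hnbr.elim hpa hch⟩

lemma adj_of_mem_ch (h : IsGraphSuperCovered G i j) {a c : V}
    (haj : G.Adj a j) (hc : c ∈ ch G i) : G.Adj a c := by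
  by_cases hai : a = i
  · exact hai ▸ hc.2
  by_cases hcj : c = j
  · exact hcj ▸ haj
  have hcj' := (h.mem_ch_iff c hcj).mp hc
  by_cases haj' : a = j
  · exact haj' ▸ hcj'.2
  · exact h.adj_of_mem_pa_of_mem_ch a ((h.mem_pa_iff a hai).mpr ⟨haj', haj⟩) c hcj'

end IsGraphSuperCovered
end SuperCovered

section ModelFlip

open Matrix

variable {V : Type*} [Fintype V] {G : Digraph V} {i j : V} {M S P : Matrix V V ℝ}

lemma lyapunov_skew_mul (hS : S.IsSymm) (hP : P.IsSymm) {K : Matrix V V ℝ} (hK : Kᵀ = -K) :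
    S * P * K * P * S + S * (S * P * K * P)ᵀ = 0 := by
  simp only [transpose_mul, hS.eq, hP.eq, hK, Matrix.mul_assoc, Matrix.neg_mul, Matrix.mul_neg,
    add_neg_cancel]

variable [DecidableEq V]

lemma mul_skew_mul_apply (X P : Matrix V V ℝ) (i j a b : V) :
    (X * (single i j 1 - single j i 1 : Matrix V V ℝ) * P) b a = X b i * P j a - X b j * P i a := by
  have hsingle : ∀ k l : V, (X * single k l (1 : ℝ) * P) b a = X b k * P l a := fun k l => by
    simp [mul_apply, single_apply, ite_and]
  rw [Matrix.mul_sub, Matrix.sub_mul, Matrix.sub_apply, hsingle, hsingle]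

namespace IsGraphSuperCovered

lemma mul_precision_apply_nonneighbour (hG : IsDAG G) (h : IsGraphSuperCovered G i j)
    (hS : S ∈ model G) (hP : IsMarginalPrecision S {a | G.Adj a j} P) {r : V}
    (hr : r ∈ {r | r ≠ i ∧ r ∉ nbr G i}) (x : V) : (S * P) r x = 0 := by
  rw [mul_apply]
  refine Finset.sum_eq_zero fun c _ => ?_
  by_cases hc : c ∈ {a | G.Adj a j}
  · rw [apply_eq_zero_of_disjoint_ancestral hS (h.isAncestral_setOf_adj hG)
      h.isAncestral_nonneighbours h.disjoint_setOf_adj_nonneighbours hc hr, zero_mul]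
  · rw [hP.apply_eq_zero c hc, mul_zero]

-- The coefficient is forced by the requirement that the entry of the removed edge vanishes.
lemma add_smul_mem_sparse_flip (hG : IsDAG G) (h : IsGraphSuperCovered G i j) (hS : S ∈ model G)
    (hP : IsMarginalPrecision S {a | G.Adj a j} P) (hM : M ∈ sparse G) :
    M + (M j i / P i i) • (S * P * (single i j 1 - single j i 1) * P)
      ∈ sparse (Lyapunov.flip G i j) := by
  intro a b hab
  rw [Matrix.add_apply, Matrix.smul_apply, smul_eq_mul, mul_skew_mul_apply]
  by_cases hai : a = i ∧ b = j
  · obtain ⟨rfl, rfl⟩ := hai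
    have hbb : b ∈ {k | G.Adj k b} := hG.1 b
    rw [hP.mul_apply_eq_one b hbb, hP.mul_apply_eq_one b hbb, one_apply_ne h.ne.symm, one_apply_eq]
    field_simp [(hP.apply_self_pos (a := a) h.adj).ne']
    ring
  have hadj : ¬ G.Adj a b := fun hadj => hab (Or.inl ⟨hadj, hai⟩)
  rw [hM a b hadj, zero_add]
  by_cases haj : G.Adj a j
  · by_cases hbj : G.Adj b j
    · rw [hP.mul_apply_eq_one b hbj, hP.mul_apply_eq_one b hbj]
      have hbj' : b ≠ j := fun hb => hadj (hb ▸ haj)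
      have hbi : b ≠ i := by
        rintro rfl
        have hai : a ≠ b := fun ha => hadj (ha ▸ hG.1 b)
        exact hadj ((h.mem_pa_iff a hai).mpr ⟨fun haj => hab (Or.inr ⟨haj, rfl⟩), haj⟩).2
      rw [one_apply_ne hbi, one_apply_ne hbj']
      ring
    · rcases h.mem_ch_or_nonneighbour hbj with hb | hb
      · exact absurd (h.adj_of_mem_ch haj hb) hadj
      · rw [h.mul_precision_apply_nonneighbour hG hS hP hb,
          h.mul_precision_apply_nonneighbour hG hS hP hb]
        ring
  · rw [hP.isSymm.apply a j, hP.isSymm.apply a i, hP.apply_eq_zero a haj, hP.apply_eq_zero a haj]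
    ring

lemma model_subset_model_flip (hG : IsDAG G) (h : IsGraphSuperCovered G i j) :
    model G ⊆ model (Lyapunov.flip G i j) := by
  intro S hS
  obtain ⟨hpd, M, hM, hL⟩ := mem_model_iff.mp hS
  obtain ⟨P, hP⟩ := exists_isMarginalPrecision hpd {a | G.Adj a j}
  refine mem_model_iff.mpr ⟨hpd, _, h.add_smul_mem_sparse_flip hG hS hP hM, ?_⟩
  have hK : (single i j 1 - single j i 1 : Matrix V V ℝ)ᵀ = -(single i j 1 - single j i 1) := by
    simp only [transpose_sub, transpose_single, neg_sub]
  calc _ = (M * S + S * Mᵀ + (2 : ℝ) • (1 : Matrix V V ℝ)) + (M j i / P i i) •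
        (S * P * (single i j 1 - single j i 1) * P * S
          + S * (S * P * (single i j 1 - single j i 1) * P)ᵀ) := by
          simp only [Matrix.add_mul, Matrix.mul_add, transpose_add, transpose_smul, smul_mul,
            Matrix.mul_smul, smul_add]
          abel
    _ = 0 := by rw [hL, lyapunov_skew_mul (isSymm_of_posDef hpd) hP.isSymm hK, smul_zero, add_zero]

theorem model_flip (hG : IsDAG G) (h : IsGraphSuperCovered G i j) :
    model (Lyapunov.flip G i j) = model G := by
  refine (h.model_subset_model_flip hG).antisymm' ?_
  have hback := (h.flip hG).model_subset_model_flip (h.isDAG_flip hG)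
  rwa [h.flip_flip hG] at hback

theorem isSuperCovered (hG : IsDAG G) (h : IsGraphSuperCovered G i j) : IsSuperCovered G i j where
  ne := h.ne
  adj := h.adj
  ch_eq := by
    ext k
    by_cases hk : k = j
    · simp [hk, ch, h.ne.symm, h.adj]
    · simp [h.mem_ch_iff k hk, hk]
  pa_eq := by
    ext k
    by_cases hk : k = i
    · simp [hk, pa, h.ne, h.adj]
    · simp [h.mem_pa_iff k hk, hk]
  pa_ch _ hk _ hl := h.adj_of_mem_ch hk.2 hl
  rest k hki hkj := by
    by_cases hk : k ∈ nbr G i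
    · exact Or.inl ⟨hk, hk.imp (h.mem_pa_iff k hki).mp (h.mem_ch_iff k hkj).mp⟩
    · refine Or.inr fun S hS => ?_
      have hzero : ∀ a ∈ {a | G.Adj a j}, S k a = 0 := fun a ha =>
        apply_eq_zero_of_disjoint_ancestral hS (h.isAncestral_setOf_adj hG)
          h.isAncestral_nonneighbours h.disjoint_setOf_adj_nonneighbours ha ⟨hki, hk⟩
      exact ⟨hzero i h.adj, hzero j (hG.1 j)⟩

end IsGraphSuperCovered

end ModelFlip

section Restriction

open Matrix

lemma posDef_fromBlocks_one_iff {W D : Type*} [Finite W] [Finite D] [DecidableEq D]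
    {S : Matrix W W ℝ} :
    (fromBlocks S 0 0 (1 : Matrix D D ℝ)).PosDef ↔ S.PosDef := by
  refine ⟨fun h => h.submatrix Sum.inl_injective, fun h => ?_⟩
  classical
  cases nonempty_fintype W
  cases nonempty_fintype D
  have := h.isUnit.invertible
  have hpsd : (fromBlocks S 0 0 (1 : Matrix D D ℝ)).PosSemidef := by
    simpa using (h.fromBlocks₁₁ (0 : Matrix W D ℝ) 1).mpr (by simpa using PosSemidef.one)
  rw [hpsd.posDef_iff_det_ne_zero, det_fromBlocks_zero₂₁, det_one, mul_one]
  exact h.det_pos.ne'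

variable {U W D : Type*} [Fintype U] [DecidableEq U] [Fintype W] [DecidableEq W] [Fintype D]
  [DecidableEq D]

lemma submatrix_mem_model_comap (e : W ≃ U) {H : Digraph U} {S : Matrix U U ℝ} (hS : S ∈ model H) :
    S.submatrix e e ∈ model (comap e H) := by
  obtain ⟨hpd, M, hM, hL⟩ := mem_model_iff.mp hS
  refine mem_model_iff.mpr ⟨hpd.submatrix e.injective, M.submatrix e e, fun a b => hM _ _, ?_⟩
  simpa [submatrix_add, submatrix_smul] using congrArg (fun X => X.submatrix e e) hL

lemma mem_model_comap_equiv_iff (e : W ≃ U) {H : Digraph U} {S : Matrix W W ℝ} :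
    S ∈ model (comap e H) ↔ S.submatrix e.symm e.symm ∈ model H := by
  refine ⟨fun hS => ?_, fun hS => ?_⟩
  · have hH : comap e.symm (comap e H) = H := by ext; simp [comap]
    simpa only [hH] using submatrix_mem_model_comap e.symm hS
  · simpa using submatrix_mem_model_comap e hS

lemma fromBlocks_one_mem_model_iff {H : Digraph (W ⊕ D)} (hH : ∀ d, H.Adj (.inr d) (.inr d))
    {S : Matrix W W ℝ} :
    fromBlocks S 0 0 (1 : Matrix D D ℝ) ∈ model H ↔ S ∈ model (comap Sum.inl H) := by
  rw [mem_model_iff, mem_model_iff, posDef_fromBlocks_one_iff]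
  refine and_congr_right fun _ => ⟨fun ⟨M, hM, hL⟩ => ?_, fun ⟨M, hM, hL⟩ => ?_⟩
  · refine ⟨M.toBlocks₁₁, fun a b => hM (.inl a) (.inl b), ?_⟩
    rw [← fromBlocks_toBlocks M, ← fromBlocks_one, fromBlocks_transpose, fromBlocks_multiply,
      fromBlocks_multiply, fromBlocks_smul, fromBlocks_add, fromBlocks_add, ← fromBlocks_zero,
      fromBlocks_inj] at hL
    simpa using hL.1
  · refine ⟨fromBlocks M 0 0 (-1), ?_, ?_⟩
    · rintro (a | a) (b | b) hab
      · exact hM a b hab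
      · rfl
      · rfl
      · have hba : b ≠ a := fun h => hab (h ▸ hH b)
        simp [one_apply_ne hba]
    · rw [← fromBlocks_one, fromBlocks_transpose, fromBlocks_multiply, fromBlocks_multiply,
        fromBlocks_smul, fromBlocks_add, fromBlocks_add, ← fromBlocks_zero, fromBlocks_inj]
      refine ⟨by simpa using hL, by simp, by simp, ?_⟩
      simp [two_smul]

theorem model_comap_eq_of_model_eq {H₁ H₂ : Digraph U} (h₁ : ∀ u, H₁.Adj u u)
    (h₂ : ∀ u, H₂.Adj u u) (h : model H₁ = model H₂) {g : W → U} (hg : g.Injective) :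
    model (comap g H₁) = model (comap g H₂) := by
  classical
  let e : W ⊕ ↥(Set.range g)ᶜ ≃ U :=
    ((Equiv.ofInjective g hg).sumCongr (Equiv.refl _)).trans (Equiv.Set.sumCompl (Set.range g))
  have hcomap : ∀ H : Digraph U, comap g H = comap Sum.inl (comap e H) := fun H => rfl
  ext S
  rw [hcomap, hcomap, ← fromBlocks_one_mem_model_iff (fun d => h₁ _),
    ← fromBlocks_one_mem_model_iff (fun d => h₂ _), mem_model_comap_equiv_iff,
    mem_model_comap_equiv_iff, h]

end Restriction

section LocallyEquivalent

variable {V : Type*} {G₁ G₂ : Digraph V}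

/-- Two DAGs whose models agree on every choice of at most four distinct vertices. -/
structure LocallyEquivalent (G₁ G₂ : Digraph V) : Prop where
  isDAG_left : IsDAG G₁
  isDAG_right : IsDAG G₂
  model_comap_eq : ∀ n ≤ 4, ∀ f : Fin n → V, f.Injective → model (comap f G₁) = model (comap f G₂)

namespace LocallyEquivalent

lemma symm (h : LocallyEquivalent G₁ G₂) : LocallyEquivalent G₂ G₁ :=
  ⟨h.isDAG_right, h.isDAG_left, fun n hn f hf => (h.model_comap_eq n hn f hf).symm⟩

lemma trans {G₃ : Digraph V} (h : LocallyEquivalent G₁ G₂) (h' : LocallyEquivalent G₂ G₃) :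
    LocallyEquivalent G₁ G₃ :=
  ⟨h.isDAG_left, h'.isDAG_right, fun n hn f hf =>
    (h.model_comap_eq n hn f hf).trans (h'.model_comap_eq n hn f hf)⟩

lemma of_model_induce_eq [Fintype V] [DecidableEq V] (hV : 4 ≤ Fintype.card V) (h₁ : IsDAG G₁)
    (h₂ : IsDAG G₂)
    (hK : ∀ K : Finset V, K.card = 4 → model (induce G₁ K) = model (induce G₂ K)) :
    LocallyEquivalent G₁ G₂ := by
  refine ⟨h₁, h₂, fun n hn f hf => ?_⟩
  obtain ⟨K, hfK, hcard⟩ := Finset.exists_superset_card_eq (s := Finset.univ.image f)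
    (Finset.card_image_le.trans (by simpa using hn)) hV
  let g : Fin n → K := fun a => ⟨f a, hfK (Finset.mem_image_of_mem f (Finset.mem_univ a))⟩
  have hg : g.Injective := fun a b hab => hf (congrArg Subtype.val hab)
  exact model_comap_eq_of_model_eq (H₁ := induce G₁ K) (fun u => h₁.1 u) (fun u => h₂.1 u)
    (hK K hcard) hg

end LocallyEquivalent

lemma IsGraphSuperCovered.locallyEquivalent_flip {G : Digraph V} {i j : V} (hG : IsDAG G)
    (h : IsGraphSuperCovered G i j) : LocallyEquivalent (Lyapunov.flip G i j) G := by
  refine ⟨h.isDAG_flip hG, hG, fun n _ f hf => ?_⟩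
  by_cases hij : i ∈ Set.range f ∧ j ∈ Set.range f
  · obtain ⟨⟨a, rfl⟩, ⟨b, rfl⟩⟩ := hij
    rw [comap_flip hf]
    exact (h.comap hf).model_flip (hG.comap hf)
  · rw [comap_flip_of_notMem_range hij]

end LocallyEquivalent

section EdgeLists

open Matrix

/-- The directed graph on `Fin n` whose non-loop edges are those listed in `E`; all self-loops are
present. -/
def ofEdges {n : ℕ} (E : List (Fin n × Fin n)) : Digraph (Fin n) where
  Adj a b := a = b ∨ (a, b) ∈ E

variable {V : Type*} [Fintype V] [DecidableEq V]

lemma model_mono {G H : Digraph V} (hGH : ∀ a b, G.Adj a b → H.Adj a b) : model G ⊆ model H :=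
  fun _ ⟨hS, M, hM, h⟩ => ⟨hS, M, fun a b hab => hM a b (mt (hGH a b) hab), h⟩

lemma mem_model_of_ldl [LinearOrder V] {G : Digraph V} {S M C : Matrix V V ℝ} {d : V → ℝ}
    (hC : C.IsUpperTriangular) (hC' : ∀ a, C a a = 1) (hd : ∀ a, 0 < d a)
    (hS : ∀ a b, ∑ c, C c a * d c * C c b = S a b) (hM : M ∈ sparse G)
    (hL : ∀ a b, (M * S) a b + (M * S) b a + 2 * (1 : Matrix V V ℝ) a b = 0) :
    S ∈ model G := by
  have hinj : Function.Injective C.mulVec := mulVec_injective_of_isUnit <| by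
    simp [isUnit_iff_isUnit_det, det_of_isUpperTriangular hC, hC']
  have hSC : Cᴴ * diagonal d * C = S := by
    ext a b
    simp only [mul_apply (M := Cᴴ * _), mul_diagonal, conjTranspose_apply, star_trivial, hS]
  have hpd : S.PosDef := hSC ▸ (posDef_diagonal_iff.mpr hd).conjTranspose_mul_mul_same hinj
  refine mem_model_iff.mpr ⟨hpd, M, hM, ?_⟩
  have hMS : S * Mᵀ = (M * S)ᵀ := by rw [transpose_mul, (isSymm_of_posDef hpd).eq]
  ext a b
  simpa only [hMS, Matrix.add_apply, transpose_apply, Matrix.smul_apply, smul_eq_mul,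
    Matrix.zero_apply] using hL a b

end EdgeLists

section Witnesses

open Matrix

lemma edge_mem_model :
    !![1, 1; 1, 3] ∈ model (ofEdges [(0, 1)] : Digraph (Fin 2)) := by
  refine mem_model_of_ldl (M := !![-1, 0; 2, -1])
    (C := !![1, 1; 0, 1])
    (d := ![1, 2]) ?_ ?_ ?_ ?_ ?_ ?_ <;>
  simp [IsUpperTriangular, BlockTriangular, sparse, ofEdges, Fin.forall_fin_succ,
    Fin.sum_univ_succ] <;>
  norm_num

lemma edge_not_model_subset_empty :
    ¬ model (ofEdges [(0, 1)] : Digraph (Fin 2)) ⊆ model (ofEdges []) := fun h => by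
  have hA : ∀ a, IsAncestral (ofEdges [] : Digraph (Fin 2)) {a} := by
    simp [IsAncestral, ofEdges]
  have h01 := apply_eq_zero_of_disjoint_ancestral (h edge_mem_model) (hA 0) (hA 1)
    (by simp) rfl rfl
  simp at h01

lemma chain_mem_model :
    !![2, 1, 1; 1, 2, 2; 1, 2, 4] ∈ model (ofEdges [(0, 1), (1, 2)] : Digraph (Fin 3)) := by
  refine mem_model_of_ldl (M := !![-1/2, 0, 0; 2/3, -5/6, 0; 0, 3/2, -1])
    (C := !![1, 1/2, 1/2; 0, 1, 1; 0, 0, 1])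
    (d := ![2, 3/2, 2]) ?_ ?_ ?_ ?_ ?_ ?_ <;>
  simp [IsUpperTriangular, BlockTriangular, sparse, ofEdges, Fin.forall_fin_succ,
    Fin.sum_univ_succ] <;>
  norm_num

lemma fork_mem_model :
    !![3, 1, 2; 1, 1, 1; 2, 1, 3] ∈ model (ofEdges [(1, 0), (1, 2)] : Digraph (Fin 3)) := by
  refine mem_model_of_ldl (M := !![-1, 2, 0; 0, -1, 0; 0, 2, -1])
    (C := !![1, 1/3, 2/3; 0, 1, 1/2; 0, 0, 1])
    (d := ![3, 2/3, 3/2]) ?_ ?_ ?_ ?_ ?_ ?_ <;>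
  simp [IsUpperTriangular, BlockTriangular, sparse, ofEdges, Fin.forall_fin_succ,
    Fin.sum_univ_succ] <;>
  norm_num

lemma apply_eq_zero_of_mem_model_collider {S : Matrix (Fin 3) (Fin 3) ℝ}
    (hS : S ∈ model (ofEdges [(0, 1), (2, 1)] : Digraph (Fin 3))) : S 2 0 = 0 := by
  have hA : ∀ a ≠ 1, IsAncestral (ofEdges [(0, 1), (2, 1)] : Digraph (Fin 3)) {a} := by
    simp [IsAncestral, ofEdges, Fin.forall_fin_succ]
  exact apply_eq_zero_of_disjoint_ancestral hS (hA 0 (by decide)) (hA 2 (by decide))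
    (by simp) rfl rfl

lemma chain_not_model_subset_collider :
    ¬ model (ofEdges [(0, 1), (1, 2)] : Digraph (Fin 3)) ⊆ model (ofEdges [(0, 1), (2, 1)]) :=
  fun h => by simpa using apply_eq_zero_of_mem_model_collider (h chain_mem_model)

lemma fork_not_model_subset_collider :
    ¬ model (ofEdges [(1, 0), (1, 2)] : Digraph (Fin 3)) ⊆ model (ofEdges [(0, 1), (2, 1)]) :=
  fun h => by simpa using apply_eq_zero_of_mem_model_collider (h fork_mem_model)

lemma chain_not_model_subset_reverse_chain :
    ¬ model (ofEdges [(0, 1), (1, 2)] : Digraph (Fin 3)) ⊆ model (ofEdges [(2, 1), (1, 0)]) := by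
  refine not_model_subset_model_of_trace_ne_zero chain_mem_model
    (Q := !![0, 4, -4; 4, -2, 0; -4, 0, 1]) ?_ ?_ ?_ <;>
  simp [IsSymm.ext_iff, trace, ofEdges, Fin.forall_fin_succ, Fin.sum_univ_succ] <;>
  norm_num

lemma fork_not_model_subset_reverse_chain :
    ¬ model (ofEdges [(1, 0), (1, 2)] : Digraph (Fin 3)) ⊆ model (ofEdges [(2, 1), (1, 0)]) := by
  refine not_model_subset_model_of_trace_ne_zero fork_mem_model
    (Q := !![2, 2, -4; 2, -1, -1; -4, -1, 3]) ?_ ?_ ?_ <;>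
  simp [IsSymm.ext_iff, trace, ofEdges, Fin.forall_fin_succ, Fin.sum_univ_succ] <;>
  norm_num

lemma parent_fork_not_model_subset_flip :
    ¬ model (ofEdges [(0, 1), (2, 0), (2, 1), (2, 3)] : Digraph (Fin 4))
      ⊆ model (ofEdges [(1, 0), (2, 0), (2, 1), (2, 3)]) := by
  have hS : !![3, 0, 1, 2; 0, 5, -1, -1; 1, -1, 1, 1; 2, -1, 1, 3]
      ∈ model (ofEdges [(0, 1), (2, 0), (2, 1), (2, 3)] : Digraph (Fin 4)) := by
    refine mem_model_of_ldl (M := !![-1, 0, 2, 0; 2, -1, -4, 0; 0, 0, -1, 0; 0, 0, 2, -1])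
      (C := !![1, 0, 1/3, 2/3; 0, 1, -1/5, -1/5; 0, 0, 1, 2/7; 0, 0, 0, 1])
      (d := ![3, 5, 7/15, 10/7]) ?_ ?_ ?_ ?_ ?_ ?_ <;>
    simp [IsUpperTriangular, BlockTriangular, sparse, ofEdges, Fin.forall_fin_succ,
      Fin.sum_univ_succ] <;>
    norm_num
  refine not_model_subset_model_of_trace_ne_zero hS
    (Q := !![0, 0, 0, 0; 0, 0, -1, 1; 0, -1, -2, 1; 0, 1, 1, 0]) ?_ ?_ ?_ <;>
  simp [IsSymm.ext_iff, trace, ofEdges, Fin.forall_fin_succ, Fin.sum_univ_succ]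
  norm_num

lemma grandparent_not_model_subset_flip :
    ¬ model (ofEdges [(0, 1), (2, 0), (2, 1), (3, 2)] : Digraph (Fin 4))
      ⊆ model (ofEdges [(1, 0), (2, 0), (2, 1), (3, 2)]) := by
  have hS : !![18, -2, 8, 2; -2, 6, -3, -1; 8, -3, 6, 2; 2, -1, 2, 2]
      ∈ model (ofEdges [(0, 1), (2, 0), (2, 1), (3, 2)] : Digraph (Fin 4)) := by
    refine mem_model_of_ldl (M := !![-1/2, 0, 1, 0; 1/2, -1/2, -1, 0; 0, 0, -1/2, 1; 0, 0, 0, -1/2])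
      (C := !![1, -1/9, 4/9, 1/9; 0, 1, -19/52, -7/52; 0, 0, 1, 43/87; 0, 0, 0, 1])
      (d := ![18, 52/9, 87/52, 110/87]) ?_ ?_ ?_ ?_ ?_ ?_ <;>
    simp [IsUpperTriangular, BlockTriangular, sparse, ofEdges, Fin.forall_fin_succ,
      Fin.sum_univ_succ] <;>
    norm_num
  refine not_model_subset_model_of_trace_ne_zero hS
    (Q := !![0, 0, 0, 0; 0, 0, -2, 6; 0, -2, -1, 0; 0, 6, 0, 3]) ?_ ?_ ?_ <;>
  simp [IsSymm.ext_iff, trace, ofEdges, Fin.forall_fin_succ, Fin.sum_univ_succ] <;>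
  norm_num

lemma child_chain_not_model_subset_flip :
    ¬ model (ofEdges [(0, 1), (0, 2), (1, 2), (2, 3)] : Digraph (Fin 4))
      ⊆ model (ofEdges [(1, 0), (0, 2), (1, 2), (2, 3)]) := by
  have hS : !![1, 1, 0, 0; 1, 3, -1, -1; 0, -1, 1, 1; 0, -1, 1, 3]
      ∈ model (ofEdges [(0, 1), (0, 2), (1, 2), (2, 3)] : Digraph (Fin 4)) := by
    refine mem_model_of_ldl (M := !![-1, 0, 0, 0; 2, -1, 0, 0; 2, -2, -3, 0; 0, 0, 2, -1])
      (C := !![1, 1, 0, 0; 0, 1, -1/2, -1/2; 0, 0, 1, 1; 0, 0, 0, 1])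
      (d := ![1, 2, 1/2, 2]) ?_ ?_ ?_ ?_ ?_ ?_ <;>
    simp [IsUpperTriangular, BlockTriangular, sparse, ofEdges, Fin.forall_fin_succ,
      Fin.sum_univ_succ] <;>
    norm_num
  refine not_model_subset_model_of_trace_ne_zero hS
    (Q := !![3, -3, 0, -6; -3, 1, 0, 0; 0, 0, 0, 0; -6, 0, 0, 0]) ?_ ?_ ?_ <;>
  simp [IsSymm.ext_iff, trace, ofEdges, Fin.forall_fin_succ, Fin.sum_univ_succ] <;>
  norm_num

lemma parent_child_not_model_subset_flip :
    ¬ model (ofEdges [(0, 1), (2, 0), (2, 1), (0, 3), (1, 3)] : Digraph (Fin 4))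
      ⊆ model (ofEdges [(1, 0), (2, 0), (2, 1), (0, 3), (1, 3)]) := by
  have hS : !![3, 1, 1, -2; 1, 1, 1, -1; 1, 1, 2, -1; -2, -1, -1, 2]
      ∈ model (ofEdges [(0, 1), (2, 0), (2, 1), (0, 3), (1, 3)] : Digraph (Fin 4)) := by
    refine mem_model_of_ldl (M :=
        !![-1/2, 0, 1/2, 0; 1/2, -3, 3/2, 0; 0, 0, -1/2, 0; -3/2, -2, 0, -3])
      (C := !![1, 1/3, 1/3, -2/3; 0, 1, 1, -1/2; 0, 0, 1, 0; 0, 0, 0, 1])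
      (d := ![3, 2/3, 1, 1/2]) ?_ ?_ ?_ ?_ ?_ ?_ <;>
    simp [IsUpperTriangular, BlockTriangular, sparse, ofEdges, Fin.forall_fin_succ,
      Fin.sum_univ_succ] <;>
    norm_num
  refine not_model_subset_model_of_trace_ne_zero hS
    (Q := !![0, 0, 0, 0; 0, -2, 0, -2; 0, 0, 1, 2; 0, -2, 2, 0]) ?_ ?_ ?_ <;>
  simp [IsSymm.ext_iff, trace, ofEdges, Fin.forall_fin_succ, Fin.sum_univ_succ]
  norm_num

end Witnesses

section LocalComparison

variable {V : Type*} {G G₁ G₂ : Digraph V} {i j k p c r : V}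

lemma LocallyEquivalent.not_forall_mem_of_not_model_subset (h : LocallyEquivalent G₁ G₂)
    {n : ℕ} (hn : n ≤ 4) {E E' : List (Fin n × Fin n)}
    (hE : ¬ model (ofEdges E) ⊆ model (ofEdges E')) {f : Fin n → V} (hf : f.Injective)
    (hG₁ : ∀ e ∈ E, G₁.Adj (f e.1) (f e.2)) :
    ¬ ∀ a b, a ≠ b → G₂.Adj (f a) (f b) → (a, b) ∈ E' := by
  intro hG₂
  refine hE ((model_mono (H := comap f G₁) ?_).trans <|
    (h.model_comap_eq n hn f hf).subset.trans <| model_mono ?_)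
  · rintro a b (rfl | hab)
    · exact h.isDAG_left.1 (f a)
    · exact hG₁ (a, b) hab
  · exact fun a b hab => or_iff_not_imp_left.mpr fun hne => hG₂ a b hne hab

lemma LocallyEquivalent.adj_or_adj (h : LocallyEquivalent G₁ G₂) (hij : i ≠ j)
    (hadj : G₁.Adj i j) : G₂.Adj i j ∨ G₂.Adj j i := by
  by_contra! hno
  refine h.not_forall_mem_of_not_model_subset (by decide) edge_not_model_subset_empty
    (f := ![i, j]) (List.nodup_ofFn.mp (by simp [hij])) (by simpa) ?_
  simp [Fin.forall_fin_succ, hno]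

lemma LocallyEquivalent.nbr_subset (h : LocallyEquivalent G₁ G₂) (i : V) :
    nbr G₁ i ⊆ nbr G₂ i := by
  rintro k (⟨hki, hk⟩ | ⟨hki, hk⟩)
  · exact (h.adj_or_adj hki hk).imp (⟨hki, ·⟩) (⟨hki, ·⟩)
  · exact ((h.adj_or_adj hki.symm hk).imp (⟨hki, ·⟩) (⟨hki, ·⟩)).symm

lemma LocallyEquivalent.nbr_eq (h : LocallyEquivalent G₁ G₂) (i : V) : nbr G₁ i = nbr G₂ i :=
  (h.nbr_subset i).antisymm (h.symm.nbr_subset i)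

lemma LocallyEquivalent.not_adj_of_notMem_nbr (h : LocallyEquivalent G₁ G₂) (hki : k ≠ i)
    (hk : k ∉ nbr G₁ i) : ¬ G₂.Adj k i ∧ ¬ G₂.Adj i k := by
  rw [h.nbr_eq] at hk
  exact ⟨fun hki' => hk (Or.inl ⟨hki, hki'⟩), fun hik => hk (Or.inr ⟨hki, hik⟩)⟩

lemma mem_nbr_comm : k ∈ nbr G i ↔ i ∈ nbr G k := by
  simp only [nbr, pa, ch, Set.mem_union, Set.mem_ofPred_eq, ne_comm (a := k), or_comm]

lemma skeleton_adj : (skeleton G).Adj i j ↔ j ∈ nbr G i := by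
  simp only [skeleton, Digraph.toSimpleGraphInclusive, SimpleGraph.fromRel_adj, nbr, pa, ch,
    Set.mem_union, Set.mem_ofPred_eq]
  tauto

lemma LocallyEquivalent.skeleton_eq (h : LocallyEquivalent G₁ G₂) : skeleton G₁ = skeleton G₂ := by
  ext i j
  rw [skeleton_adj, skeleton_adj, h.nbr_eq]

/-- The edge `i → j` of `G₁` occurs in `G₂` with the opposite orientation. -/
structure Reversed (G₁ G₂ : Digraph V) (i j : V) : Prop where
  ne : i ≠ j
  left : G₁.Adj i j
  right : G₂.Adj j i

lemma Reversed.symm (hr : Reversed G₁ G₂ i j) : Reversed G₂ G₁ j i :=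
  ⟨hr.ne.symm, hr.right, hr.left⟩

lemma Reversed.mem_nbr_right (h : LocallyEquivalent G₁ G₂) (hr : Reversed G₁ G₂ i j)
    (hkj : k ≠ j) (hk : k ∈ nbr G₁ i) : k ∈ nbr G₁ j := by
  by_contra hno
  have hki : k ≠ i := hk.elim And.left And.left
  have hf : Function.Injective ![k, i, j] := List.nodup_ofFn.mp (by simp [hki, hkj, hr.ne])
  have hij := h.isDAG_right.not_adj_symm hr.ne.symm hr.right
  have hno' : ¬ G₂.Adj k j ∧ ¬ G₂.Adj j k := h.not_adj_of_notMem_nbr hkj hno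
  have hnot_chain_fork : ∀ E : List (Fin 3 × Fin 3),
      (∀ e ∈ E, G₁.Adj (![k, i, j] e.1) (![k, i, j] e.2)) →
      (¬ model (ofEdges E) ⊆ model (ofEdges [(0, 1), (2, 1)])) →
      ¬ model (ofEdges E) ⊆ model (ofEdges [(2, 1), (1, 0)]) → False := by
    intro E hE hcollider hreverse
    rcases h.nbr_eq i ▸ hk with ⟨-, hk'⟩ | ⟨-, hk'⟩
    · refine h.not_forall_mem_of_not_model_subset (by decide) hcollider hf hE ?_
      simp [Fin.forall_fin_succ, hno', hij, h.isDAG_right.not_adj_symm hki hk']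
    · refine h.not_forall_mem_of_not_model_subset (by decide) hreverse hf hE ?_
      simp [Fin.forall_fin_succ, hno', hij, h.isDAG_right.not_adj_symm hki.symm hk']
  rcases hk with ⟨-, hk⟩ | ⟨-, hk⟩
  · exact hnot_chain_fork [(0, 1), (1, 2)] (by simp [hk, hr.left])
      chain_not_model_subset_collider chain_not_model_subset_reverse_chain
  · exact hnot_chain_fork [(1, 0), (1, 2)] (by simp [hk, hr.left])
      fork_not_model_subset_collider fork_not_model_subset_reverse_chain

lemma Reversed.mem_nbr_iff (h : LocallyEquivalent G₁ G₂) (hr : Reversed G₁ G₂ i j)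
    (hki : k ≠ i) (hkj : k ≠ j) : k ∈ nbr G₁ i ↔ k ∈ nbr G₁ j := by
  refine ⟨hr.mem_nbr_right h hkj, ?_⟩
  rw [h.nbr_eq, h.nbr_eq]
  exact hr.symm.mem_nbr_right h.symm hki

lemma LocallyEquivalent.not_adj_symm_of_not_mem_nbr_iff (h : LocallyEquivalent G₁ G₂)
    (hij : i ≠ j) (hadj : G₁.Adj i j) (hki : k ≠ i) (hkj : k ≠ j)
    (hk : ¬ (k ∈ nbr G₁ i ↔ k ∈ nbr G₁ j)) : ¬ G₂.Adj j i :=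
  fun hji => hk (Reversed.mem_nbr_iff h ⟨hij, hadj, hji⟩ hki hkj)

lemma IsDAG.exists_numbering [Finite V] (hG : IsDAG G) :
    ∃ ℓ : V → ℕ, ∀ a b, a ≠ b → G.Adj a b → ℓ a < ℓ b :=
  ⟨fun a => {k | Relation.TransGen (fun x y => x ≠ y ∧ G.Adj x y) k a}.ncard, fun a _ hne hab =>
    Set.ncard_lt_ncard
      ⟨fun _ hk => hk.tail ⟨hne, hab⟩, fun hsub => hG.2 a (hsub (.single ⟨hne, hab⟩))⟩
      (Set.toFinite _)⟩

lemma LocallyEquivalent.exists_reversed_disjoint [Finite V] (h : LocallyEquivalent G₁ G₂)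
    (hne : (edges G₁ \ edges G₂).Nonempty) :
    ∃ i j, Reversed G₁ G₂ i j ∧ Disjoint (ch G₁ i) (pa G₁ j) := by
  obtain ⟨⟨a, b⟩, hab, hab'⟩ := hne
  have hne : a ≠ b := fun hab'' => hab' (hab'' ▸ h.isDAG_right.1 a)
  have hr : Reversed G₁ G₂ a b := ⟨hne, hab, (h.adj_or_adj hne hab).resolve_left hab'⟩
  obtain ⟨ℓ, hℓ⟩ := h.isDAG_left.exists_numbering
  obtain ⟨⟨i, j⟩, hij, hmin⟩ := Set.exists_min_image {e : V × V | Reversed G₁ G₂ e.1 e.2}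
    (fun e => ℓ e.2 - ℓ e.1) (Set.toFinite _) ⟨(a, b), hr⟩
  refine ⟨i, j, hij, Set.disjoint_left.mpr fun k ⟨hki, hik⟩ ⟨hkj, hkj'⟩ => ?_⟩
  have hik_lt := hℓ i k hki.symm hik
  have hkj_lt := hℓ k j hkj hkj'
  rcases h.adj_or_adj hki.symm hik with hik₂ | hki₂
  · rcases h.adj_or_adj hkj hkj' with hkj₂ | hjk₂
    · exact h.isDAG_right.not_adj_of_path hki.symm hkj hik₂ hkj₂ hij.right
    · have : ℓ j - ℓ i ≤ ℓ j - ℓ k := hmin (k, j) ⟨hkj, hkj', hjk₂⟩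
      omega
  · have : ℓ j - ℓ i ≤ ℓ k - ℓ i := hmin (i, k) ⟨hki.symm, hik, hki₂⟩
    omega

end LocalComparison

section ReversedEdge

variable {V : Type*} {G₁ G₂ : Digraph V} {i j : V}

namespace Reversed

lemma mem_pa_iff (h : LocallyEquivalent G₁ G₂) (hr : Reversed G₁ G₂ i j)
    (hd : Disjoint (ch G₁ i) (pa G₁ j)) {k : V} (hki : k ≠ i) : k ∈ pa G₁ i ↔ k ∈ pa G₁ j := by
  constructor <;> intro hk
  · have hkj : k ≠ j := fun hkj => h.isDAG_left.not_adj_symm hr.ne hr.left (hkj ▸ hk.2)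
    refine ((hr.mem_nbr_iff h hki hkj).mp (Or.inl hk)).resolve_right fun hk' => ?_
    exact h.isDAG_left.not_adj_of_path hr.ne hkj.symm hr.left hk'.2 hk.2
  · exact ((hr.mem_nbr_iff h hki hk.1).mpr (Or.inl hk)).resolve_right
      fun hk' => Set.disjoint_left.mp hd hk' hk

lemma mem_ch_iff (h : LocallyEquivalent G₁ G₂) (hr : Reversed G₁ G₂ i j)
    (hd : Disjoint (ch G₁ i) (pa G₁ j)) {k : V} (hkj : k ≠ j) : k ∈ ch G₁ i ↔ k ∈ ch G₁ j := by
  constructor <;> intro hk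
  · exact ((hr.mem_nbr_iff h hk.1 hkj).mp (Or.inr hk)).resolve_left
      fun hk' => Set.disjoint_left.mp hd hk hk'
  · have hki : k ≠ i := fun hki => h.isDAG_left.not_adj_symm hr.ne hr.left (hki ▸ hk.2)
    refine ((hr.mem_nbr_iff h hki hkj).mpr (Or.inr hk)).resolve_left fun hk' => ?_
    exact h.isDAG_left.not_adj_of_path hr.ne hkj.symm hr.left hk.2 hk'.2

lemma adj_of_mem_pa_of_mem_ch (h : LocallyEquivalent G₁ G₂) (hr : Reversed G₁ G₂ i j)
    (hd : Disjoint (ch G₁ i) (pa G₁ j)) {p c : V} (hp : p ∈ pa G₁ i) (hc : c ∈ ch G₁ j) :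
    G₁.Adj p c := by
  by_contra hpc
  have hp' := (hr.mem_pa_iff h hd hp.1).mp hp
  have hc' := (hr.mem_ch_iff h hd hc.1).mpr hc
  have hcp := h.isDAG_left.not_adj_of_path hp.1 hc'.1.symm hp.2 hc'.2
  have hpc_ne : p ≠ c := fun hpc' => hpc (hpc' ▸ h.isDAG_left.1 p)
  have hp_c : p ∉ nbr G₁ c := by simp [nbr, pa, ch, hpc, hcp]
  have hc_p : c ∉ nbr G₁ p := mem_nbr_comm.not.mp hp_c
  obtain ⟨hpc₂, hcp₂⟩ := h.not_adj_of_notMem_nbr hpc_ne hp_c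
  have hip : ¬ G₂.Adj i p := h.not_adj_symm_of_not_mem_nbr_iff hp.1 hp.2 hpc_ne.symm hc'.1
    fun hiff => hc_p (hiff.mpr (Or.inr hc'))
  have hjp : ¬ G₂.Adj j p := h.not_adj_symm_of_not_mem_nbr_iff hp'.1 hp'.2 hpc_ne.symm hc.1
    fun hiff => hc_p (hiff.mpr (Or.inr hc))
  have hci : ¬ G₂.Adj c i := h.not_adj_symm_of_not_mem_nbr_iff hc'.1.symm hc'.2 hp.1 hpc_ne
    fun hiff => hp_c (hiff.mp (Or.inl hp))
  have hcj : ¬ G₂.Adj c j := h.not_adj_symm_of_not_mem_nbr_iff hc.1.symm hc.2 hp'.1 hpc_ne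
    fun hiff => hp_c (hiff.mp (Or.inl hp'))
  refine h.not_forall_mem_of_not_model_subset le_rfl parent_child_not_model_subset_flip
    (f := ![i, j, p, c])
    (List.nodup_ofFn.mp (by simp [hr.ne, hp.1.symm, hp'.1.symm, hc.1.symm, hc'.1.symm, hpc_ne]))
    (by simp [hr.left, hp.2, hp'.2, hc.2, hc'.2]) ?_
  simp [Fin.forall_fin_succ, h.isDAG_right.not_adj_symm hr.ne.symm hr.right, hpc₂, hcp₂, hip,
    hjp, hci, hcj]

lemma notMem_nbr_pa (h : LocallyEquivalent G₁ G₂) (hr : Reversed G₁ G₂ i j)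
    (hd : Disjoint (ch G₁ i) (pa G₁ j)) {p r : V} (hri : r ∉ nbr G₁ i) (hri_ne : r ≠ i)
    (hp : p ∈ pa G₁ i) : r ∉ nbr G₁ p := by
  intro hrp
  have hrp_ne : r ≠ p := hrp.elim And.left And.left
  have hrj_ne : r ≠ j := fun hrj => hri (Or.inr ⟨hri_ne, hrj ▸ hr.left⟩)
  have hrj : r ∉ nbr G₁ j := (hr.mem_nbr_iff h hri_ne hrj_ne).not.mp hri
  have hp' := (hr.mem_pa_iff h hd hp.1).mp hp
  obtain ⟨hri₂, hir₂⟩ := h.not_adj_of_notMem_nbr hri_ne hri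
  obtain ⟨hrj₂, hjr₂⟩ := h.not_adj_of_notMem_nbr hrj_ne hrj
  have hip : ¬ G₂.Adj i p := h.not_adj_symm_of_not_mem_nbr_iff hp.1 hp.2 hrp_ne hri_ne
    fun hiff => hri (hiff.mp hrp)
  have hjp : ¬ G₂.Adj j p := h.not_adj_symm_of_not_mem_nbr_iff hp'.1 hp'.2 hrp_ne hrj_ne
    fun hiff => hrj (hiff.mp hrp)
  have hij := h.isDAG_right.not_adj_symm hr.ne.symm hr.right
  have hf : Function.Injective ![i, j, p, r] := List.nodup_ofFn.mp <| by
    simp [hr.ne, hp.1.symm, hp'.1.symm, hri_ne.symm, hrj_ne.symm, hrp_ne.symm]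
  have hi_r : i ∉ nbr G₁ r := mem_nbr_comm.not.mp hri
  have hi_p : i ∈ nbr G₁ p := Or.inr ⟨hp.1.symm, hp.2⟩
  rcases hrp with ⟨-, hrp⟩ | ⟨-, hpr⟩
  · have hpr₂ : ¬ G₂.Adj p r := h.not_adj_symm_of_not_mem_nbr_iff hrp_ne hrp hri_ne.symm
      hp.1.symm fun hiff => hi_r (hiff.mpr hi_p)
    refine h.not_forall_mem_of_not_model_subset le_rfl grandparent_not_model_subset_flip hf
      (by simp [hr.left, hp.2, hp'.2, hrp]) ?_
    simp [Fin.forall_fin_succ, hij, hri₂, hir₂, hrj₂, hjr₂, hip, hjp, hpr₂]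
  · have hrp₂ : ¬ G₂.Adj r p := h.not_adj_symm_of_not_mem_nbr_iff hrp_ne.symm hpr hp.1.symm
      hri_ne.symm fun hiff => hi_r (hiff.mp hi_p)
    refine h.not_forall_mem_of_not_model_subset le_rfl parent_fork_not_model_subset_flip hf
      (by simp [hr.left, hp.2, hp'.2, hpr]) ?_
    simp [Fin.forall_fin_succ, hij, hri₂, hir₂, hrj₂, hjr₂, hip, hjp, hrp₂]

lemma not_adj_of_mem_ch (h : LocallyEquivalent G₁ G₂) (hr : Reversed G₁ G₂ i j)
    (hd : Disjoint (ch G₁ i) (pa G₁ j)) {c r : V} (hri : r ∉ nbr G₁ i) (hri_ne : r ≠ i)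
    (hc : c ∈ ch G₁ j) : ¬ G₁.Adj c r := by
  intro hcr
  have hrj_ne : r ≠ j := fun hrj => hri (Or.inr ⟨hri_ne, hrj ▸ hr.left⟩)
  have hrj : r ∉ nbr G₁ j := (hr.mem_nbr_iff h hri_ne hrj_ne).not.mp hri
  have hc' := (hr.mem_ch_iff h hd hc.1).mpr hc
  have hrc_ne : r ≠ c := fun hrc => hri (Or.inr (hrc ▸ hc'))
  have hrc : r ∈ nbr G₁ c := Or.inr ⟨hrc_ne, hcr⟩
  obtain ⟨hri₂, hir₂⟩ := h.not_adj_of_notMem_nbr hri_ne hri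
  obtain ⟨hrj₂, hjr₂⟩ := h.not_adj_of_notMem_nbr hrj_ne hrj
  have hci : ¬ G₂.Adj c i := h.not_adj_symm_of_not_mem_nbr_iff hc'.1.symm hc'.2 hri_ne hrc_ne
    fun hiff => hri (hiff.mpr hrc)
  have hcj : ¬ G₂.Adj c j := h.not_adj_symm_of_not_mem_nbr_iff hc.1.symm hc.2 hrj_ne hrc_ne
    fun hiff => hrj (hiff.mpr hrc)
  have hrc₂ : ¬ G₂.Adj r c := h.not_adj_symm_of_not_mem_nbr_iff hrc_ne.symm hcr hc'.1.symm
    hri_ne.symm fun hiff => mem_nbr_comm.not.mp hri (hiff.mp (Or.inl ⟨hc'.1.symm, hc'.2⟩))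
  refine h.not_forall_mem_of_not_model_subset le_rfl child_chain_not_model_subset_flip
    (f := ![i, j, c, r]) (List.nodup_ofFn.mp (by
      simp [hr.ne, hc.1.symm, hc'.1.symm, hri_ne.symm, hrj_ne.symm, hrc_ne.symm]))
    (by simp [hr.left, hc.2, hc'.2, hcr]) ?_
  simp [Fin.forall_fin_succ, h.isDAG_right.not_adj_symm hr.ne.symm hr.right, hri₂, hir₂, hrj₂,
    hjr₂, hci, hcj, hrc₂]

lemma isGraphSuperCovered (h : LocallyEquivalent G₁ G₂) (hr : Reversed G₁ G₂ i j)
    (hd : Disjoint (ch G₁ i) (pa G₁ j)) : IsGraphSuperCovered G₁ i j where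
  ne := hr.ne
  adj := hr.left
  mem_pa_iff _ hk := hr.mem_pa_iff h hd hk
  mem_ch_iff _ hk := hr.mem_ch_iff h hd hk
  adj_of_mem_pa_of_mem_ch _ hp _ hc := hr.adj_of_mem_pa_of_mem_ch h hd hp hc
  notMem_nbr_pa _ hr' hne _ hp := hr.notMem_nbr_pa h hd hr' hne hp
  not_adj_of_mem_ch _ hr' hne _ hc := hr.not_adj_of_mem_ch h hd hr' hne hc

lemma edges_flip_diff (hr : Reversed G₁ G₂ i j) :
    edges (flip G₁ i j) \ edges G₂ = (edges G₁ \ edges G₂) \ {(i, j)} := by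
  ext ⟨a, b⟩
  simp only [edges, flip, Set.mem_sdiff, Set.mem_ofPred_eq, Set.mem_singleton_iff, Prod.mk.injEq]
  grind [hr.right]

end Reversed

lemma LocallyEquivalent.eq_of_edges_subset (h : LocallyEquivalent G₁ G₂)
    (hsub : edges G₁ ⊆ edges G₂) : G₁ = G₂ := by
  ext a b
  refine ⟨fun hab => hsub (show (a, b) ∈ edges G₁ from hab), fun hab => ?_⟩
  by_cases hne : a = b
  · exact hne ▸ h.isDAG_left.1 a
  · exact (h.symm.adj_or_adj hne hab).resolve_right fun hba =>
      h.isDAG_right.not_adj_symm hne hab (hsub (show (b, a) ∈ edges G₁ from hba))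

end ReversedEdge

section FlipSequences

variable {V : Type*} [Fintype V] [DecidableEq V] {G₁ G₂ : Digraph V}

lemma TransformsInFlips.refl (hG : IsDAG G₁) : TransformsInFlips 0 G₁ G₁ :=
  ⟨fun _ => G₁, rfl, rfl, fun _ => hG, fun t => t.elim0⟩

lemma TransformsInFlips.cons {n : ℕ} {G G' G'' : Digraph V}
    (hflip : IsSuperCoveredFlip G G') (h : TransformsInFlips n G' G'') :
    TransformsInFlips (n + 1) G G'' := by
  obtain ⟨H, h0, hn, hdag, hstep⟩ := h
  refine ⟨Fin.cons G H, rfl, by rw [← Fin.succ_last, Fin.cons_succ, hn], ?_, ?_⟩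
  · exact Fin.cases hflip.1 hdag
  · refine Fin.cases (by simpa [h0] using hflip) fun t => ?_
    rw [Fin.cons_succ, ← Fin.succ_castSucc, Fin.cons_succ]
    exact hstep t

lemma LocallyEquivalent.transformsInFlips_and_model_eq (h : LocallyEquivalent G₁ G₂) :
    TransformsInFlips (edges G₁ \ edges G₂).ncard G₁ G₂ ∧ model G₁ = model G₂ := by
  induction hn : (edges G₁ \ edges G₂).ncard generalizing G₁ with
  | zero =>
    have hsub := Set.sdiff_eq_empty.mp ((Set.ncard_eq_zero (Set.toFinite _)).mp hn)
    obtain rfl := h.eq_of_edges_subset hsub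
    exact ⟨.refl h.isDAG_left, rfl⟩
  | succ n ih =>
    obtain ⟨i, j, hr, hd⟩ := h.exists_reversed_disjoint <| by
      rw [← Set.ncard_pos (Set.toFinite _)]; omega
    have hij : IsGraphSuperCovered G₁ i j := hr.isGraphSuperCovered h hd
    have hcard : (edges (flip G₁ i j) \ edges G₂).ncard = n := by
      rw [hr.edges_flip_diff, Set.ncard_sdiff_singleton_of_mem, hn, Nat.add_sub_cancel]
      exact ⟨hr.left, h.isDAG_right.not_adj_symm hr.ne.symm hr.right⟩
    obtain ⟨hseq, hmodel⟩ := ih ((hij.locallyEquivalent_flip h.isDAG_left).trans h) hcard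
    exact ⟨hseq.cons ⟨h.isDAG_left, i, j, hij.isSuperCovered h.isDAG_left, rfl⟩,
      (hij.model_flip h.isDAG_left).symm.trans hmodel⟩

end FlipSequences

end Lyapunov

theorem mainTheorem4 {V : Type*} [Fintype V] [DecidableEq V] (hV : 4 ≤ Fintype.card V)
    (G₁ G₂ : Digraph V) (h₁ : Lyapunov.IsDAG G₁) (h₂ : Lyapunov.IsDAG G₂)
    (hK : ∀ K : Finset V, K.card = 4 →
      Lyapunov.model (Lyapunov.induce G₁ K) = Lyapunov.model (Lyapunov.induce G₂ K)) :
    Lyapunov.skeleton G₁ = Lyapunov.skeleton G₂ ∧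
    Lyapunov.TransformsInFlips (Lyapunov.edges G₁ \ Lyapunov.edges G₂).ncard G₁ G₂ ∧
    Lyapunov.model G₁ = Lyapunov.model G₂ := by
  have h := Lyapunov.LocallyEquivalent.of_model_induce_eq hV h₁ h₂ hK
  exact ⟨h.skeleton_eq, h.transformsInFlips_and_model_eq⟩
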